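/- Let $a,b,c,d$ be positive real numbers and let $\{W_n(z)\}_{n\ge 0}$ be the sequence of real polynomials defined by $W_0(z)=1$, $W_1(z)=z$ and \[ W_n(z)=(az+b)\,W_{n-1}(z)+(cz+d)\,W_{n-2}(z)\qquad (n\ge 2). \] Call a nonzero real polynomial real-rooted if all of its complex zeros are real (so nonzero constants are real-rooted). Then every polynomial $W_n(z)$, $n\ge 0$, is real-rooted if and only if $ad\le bc$. -/

import Mathlib

open Polynomial

/-- A real polynomial is real-rooted if all of its complex zeros are real. -/
def IsRealRooted (P : ℝ[X]) : Prop :=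
  ∀ z : ℂ, aeval z P = 0 → z.im = 0

/-! If ad < bc, then at x = -d/c the second coefficient vanishes while ax + b > 0, so every W_n(x),
n ≥ 1, inherits the negative sign of x. As W_n(0) > 0 for n ≥ 2, one zero lies in (x, 0); the others
interlace below x (`exists_factorization`). Hence |W_{k+1}(z)| ≥ a^k |Im z|^{k+1}, a bound that
survives letting d increase to its value, which covers ad = bc.

Conversely let ad > bc, m = -b/a and β = cm + d > 0. Real zeros force |W_n(m-t)| |W_n(m+t)| ≤
|W_n(m+it)|² (`IsRealRooted.norm_aeval_mul_le`). By the Binet formula these sides grow like powers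
of dominant characteristic roots. The rate on the left exceeds β by a term linear in t
(`lt_mul_of_small`), on the right only by O(t²) (`normSq_le_of_sq_eq`), so small t > 0 gives a
contradiction. -/

/-- The sequence of polynomials with `W₀ = 1`, `W₁ = X` obeying the recurrence with linear
coefficients `aX + b` and `cX + d`. -/
structure IsLinRec (a b c d : ℝ) (W : ℕ → ℝ[X]) : Prop where
  zero : W 0 = 1
  one : W 1 = X
  step : ∀ n : ℕ, W (n + 2) = (C a * X + C b) * W (n + 1) + (C c * X + C d) * W n

/-! ### Degrees and signs at 0 and at -d/c -/

namespace IsLinRec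

variable {a b c d : ℝ} {W : ℕ → ℝ[X]}

theorem natDegree_le_and_coeff (h : IsLinRec a b c d W) (n : ℕ) :
    (W n).natDegree ≤ n ∧ (W (n + 1)).natDegree ≤ n + 1 ∧ (W (n + 1)).coeff (n + 1) = a ^ n := by
  induction n with
  | zero => simp [h.zero, h.one]
  | succ n ih =>
    obtain ⟨h0, h1, h2⟩ := ih
    refine ⟨h1, ?_, ?_⟩
    · rw [h.step]
      refine (natDegree_add_le_of_degree_le (n := n + 2) ?_ ?_)
      · refine natDegree_mul_le.trans ?_
        have := natDegree_linear_le (a := a) (b := b)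
        omega
      · refine natDegree_mul_le.trans ?_
        have := natDegree_linear_le (a := c) (b := d)
        omega
    · have e1 : (W (n + 1)).coeff (n + 2) = 0 := coeff_eq_zero_of_natDegree_lt (by omega)
      have e2 : (W n).coeff (n + 2) = 0 := coeff_eq_zero_of_natDegree_lt (by omega)
      have e3 : (W n).coeff (n + 1) = 0 := coeff_eq_zero_of_natDegree_lt (by omega)
      rw [h.step]
      simp only [add_mul, mul_assoc, coeff_add, coeff_C_mul, coeff_X_mul, e1, e2, e3, h2]
      ring

theorem natDegree_succ (h : IsLinRec a b c d W) (ha : a ≠ 0) (n : ℕ) :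
    (W (n + 1)).natDegree = n + 1 :=
  le_antisymm (h.natDegree_le_and_coeff n).2.1 <| le_natDegree_of_ne_zero <| by
    rw [(h.natDegree_le_and_coeff n).2.2]; exact pow_ne_zero _ ha

theorem leadingCoeff_succ (h : IsLinRec a b c d W) (ha : a ≠ 0) (n : ℕ) :
    (W (n + 1)).leadingCoeff = a ^ n := by
  rw [leadingCoeff, h.natDegree_succ ha, (h.natDegree_le_and_coeff n).2.2]

theorem aeval_step (h : IsLinRec a b c d W) {A : Type*} [CommRing A] [Algebra ℝ A] (z : A) (n : ℕ) :
    aeval z (W (n + 2)) = (algebraMap ℝ A a * z + algebraMap ℝ A b) * aeval z (W (n + 1)) +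
      (algebraMap ℝ A c * z + algebraMap ℝ A d) * aeval z (W n) := by
  simp [h.step]

theorem eval_step (h : IsLinRec a b c d W) (x : ℝ) (n : ℕ) :
    (W (n + 2)).eval x = (a * x + b) * (W (n + 1)).eval x + (c * x + d) * (W n).eval x := by
  simp [h.step]

theorem eval_zero_nonneg (h : IsLinRec a b c d W) (hb : 0 < b) (hd : 0 < d) (n : ℕ) :
    0 ≤ (W (n + 1)).eval 0 ∧ 0 < (W n).eval 0 + (W (n + 1)).eval 0 ∧ 0 ≤ (W n).eval 0 ∧
      0 < (W (n + 2)).eval 0 := by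
  induction n with
  | zero => simp [h.eval_step, h.zero, h.one, hd]
  | succ n ih =>
    obtain ⟨h1, h2, h3, h4⟩ := ih
    refine ⟨h4.le, by linarith, h1, ?_⟩
    rw [h.eval_step]
    simp only [mul_zero, zero_add]
    positivity

theorem eval_root_neg (h : IsLinRec a b c d W) {x : ℝ} (hx : x < 0) (hA : 0 < a * x + b)
    (hB : c * x + d = 0) (n : ℕ) : (W (n + 1)).eval x < 0 := by
  induction n with
  | zero => simpa [h.one] using hx
  | succ n ih =>
    rw [h.eval_step, hB, zero_mul, add_zero]
    exact mul_neg_of_pos_of_neg hA ih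

end IsLinRec

/-! ### Locating roots by sign changes -/

theorem prod_range_sub_sign {y : ℕ → ℝ} {x : ℝ} {i k : ℕ} (hik : i ≤ k)
    (hlt : ∀ j < i, x < y j) (hgt : ∀ j, i ≤ j → j < k → y j < x) :
    0 < (-1) ^ i * ∏ j ∈ Finset.range k, (x - y j) := by
  rw [← Finset.prod_range_mul_prod_Ico _ hik, ← mul_assoc]
  refine mul_pos ?_ (Finset.prod_pos fun j hj => ?_)
  · have : (-1 : ℝ) ^ i * ∏ j ∈ Finset.range i, (x - y j) = ∏ j ∈ Finset.range i, (y j - x) := by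
      rw [← Finset.card_range i, ← Finset.prod_const, Finset.card_range, ← Finset.prod_mul_distrib]
      exact Finset.prod_congr rfl fun j _ => by ring
    rw [this]
    exact Finset.prod_pos fun j hj => sub_pos.2 (hlt j (Finset.mem_range.1 hj))
  · rw [Finset.mem_Ico] at hj
    exact sub_pos.2 (hgt j hj.1 hj.2)

theorem exists_root_Ioo_of_sign {p : ℝ[X]} {s u v : ℝ} (huv : u < v) (hs : s ≠ 0)
    (hu : 0 < s * p.eval u) (hv : s * p.eval v < 0) : ∃ r, u < r ∧ r < v ∧ p.eval r = 0 := by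
  have hc : ContinuousOn (fun x => s * p.eval x) (Set.Icc u v) := by fun_prop
  obtain ⟨r, hr, h0⟩ := intermediate_value_Ioo' huv.le hc ⟨hv, hu⟩
  exact ⟨r, hr.1, hr.2, (mul_eq_zero.1 h0).resolve_left hs⟩

theorem exists_lt_eval_sign {p : ℝ[X]} (hdeg : 0 < p.natDegree) (hl : 0 < p.leadingCoeff) (t : ℝ) :
    ∃ M < t, 0 < (-1) ^ p.natDegree * p.eval M := by
  have hq : (C ((-1 : ℝ) ^ p.natDegree) * p.comp (-X)).leadingCoeff = p.leadingCoeff := by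
    rw [leadingCoeff_mul, comp_neg_X_leadingCoeff_eq, leadingCoeff_C, ← mul_assoc, ← mul_pow]
    simp
  have hne : (-1 : ℝ) ^ p.natDegree ≠ 0 := pow_ne_zero _ (by norm_num)
  have hd : 0 < (C ((-1 : ℝ) ^ p.natDegree) * p.comp (-X)).degree := by
    rw [← natDegree_pos_iff_degree_pos, natDegree_C_mul hne, natDegree_comp]
    simpa using hdeg
  have ht := tendsto_atTop_of_leadingCoeff_nonneg _ hd (hq ▸ hl.le)
  obtain ⟨x, hx, hxt⟩ := ((ht.eventually_gt_atTop 0).and (Filter.eventually_gt_atTop (-t))).exists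
  refine ⟨-x, by linarith, by simpa using hx⟩

theorem eq_C_mul_prod_of_roots {p : ℝ[X]} {k : ℕ} {ζ : ℝ} {r : ℕ → ℝ} (hp : p.natDegree = k + 1)
    (hζ : p.eval ζ = 0) (hr : ∀ i < k, p.eval (r i) = 0) (hζr : ∀ i < k, r i < ζ)
    (hanti : ∀ i j, i < j → j < k → r j < r i) :
    p = C p.leadingCoeff * ((X - C ζ) * ∏ i ∈ Finset.range k, (X - C (r i))) := by
  have hp0 : p ≠ 0 := by rintro rfl; simp at hp
  have hm : ((X - C ζ) * ∏ i ∈ Finset.range k, (X - C (r i))).Monic :=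
    (monic_X_sub_C ζ).mul (monic_prod_of_monic _ _ fun i _ => monic_X_sub_C _)
  have hinj : Set.InjOn r (Finset.range k) := by
    intro i hi j hj hij
    simp only [Finset.coe_range, Set.mem_Iio] at hi hj
    rcases lt_trichotomy i j with h | h | h
    · exact absurd hij (hanti i j h hj).ne'
    · exact h
    · exact absurd hij (hanti j i h hi).ne
  have hnot : ζ ∉ (Finset.range k).image r := by
    simp only [Finset.mem_image, Finset.mem_range, not_exists, not_and]
    exact fun i hi => (hζr i hi).ne
  have hcard : (insert ζ ((Finset.range k).image r)).card = k + 1 := by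
    rw [Finset.card_insert_of_notMem hnot, Finset.card_image_of_injOn hinj, Finset.card_range]
  have hdeg : p.degree = (k + 1 : ℕ) := by rw [degree_eq_natDegree hp0, hp]
  refine eq_of_degree_le_of_eval_finset_eq (insert ζ ((Finset.range k).image r)) ?_ ?_ ?_ ?_
  · rw [hcard, hdeg]
  · have : (∏ i ∈ Finset.range k, (X - C (r i))).degree = ((k : ℕ) : WithBot ℕ) := by
      rw [degree_prod]; simp
    rw [degree_C_mul (leadingCoeff_ne_zero.2 hp0), degree_mul, this, degree_X_sub_C, hdeg]
    push_cast; ring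
  · rw [leadingCoeff_mul, hm.leadingCoeff, leadingCoeff_C, mul_one]
  · intro x hx
    rw [Finset.mem_insert, Finset.mem_image] at hx
    rcases hx with rfl | ⟨i, hi, rfl⟩
    · simp [hζ]
    · rw [hr i (Finset.mem_range.1 hi), eval_mul, eval_mul, eval_prod,
        Finset.prod_eq_zero hi (by simp)]
      simp

/-! ### Interlacing when ad < bc -/

namespace IsLinRec

variable {a b c d : ℝ} {W : ℕ → ℝ[X]}

/-- The sign clause carries the interlacing: at a zero of W_{k+1} the recurrence leaves only (cx +
d) W_k, and cx + d < 0 below -d/c. -/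
theorem exists_factorization (h : IsLinRec a b c d W) (ha : 0 < a) (hb : 0 < b) (hc : 0 < c)
    (hd : 0 < d) {x : ℝ} (hx : x < 0) (hA : 0 < a * x + b) (hB : c * x + d = 0) (k : ℕ) :
    ∃ (ζ : ℝ) (y : ℕ → ℝ), x < ζ ∧ (∀ i j, i < j → j < k → y j < y i) ∧ (∀ i < k, y i < x) ∧
      (∀ i < k, (-1) ^ i * (W k).eval (y i) < 0) ∧
      W (k + 1) = C (a ^ k) * ((X - C ζ) * ∏ i ∈ Finset.range k, (X - C (y i))) := by
  induction k with
  | zero => exact ⟨0, fun _ => 0, hx, by simp, by simp, by simp, by simp [h.one]⟩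
  | succ k ih =>
    obtain ⟨ζ, y, hζ, hanti, hyx, hsign, hfac⟩ := ih
    have hdeg : (W (k + 2)).natDegree = k + 2 := h.natDegree_succ ha.ne' (k + 1)
    have hlead : (W (k + 2)).leadingCoeff = a ^ (k + 1) := h.leadingCoeff_succ ha.ne' (k + 1)
    have hroot : ∀ i < k, (W (k + 1)).eval (y i) = 0 := by
      intro i hi
      rw [hfac, eval_mul, eval_mul, eval_prod,
        Finset.prod_eq_zero (Finset.mem_range.2 hi) (by simp)]
      simp
    have hW2y : ∀ i < k, 0 < (-1) ^ i * (W (k + 2)).eval (y i) := by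
      intro i hi
      rw [h.eval_step, hroot i hi, mul_zero, zero_add, mul_left_comm]
      exact mul_pos_of_neg_of_neg (by nlinarith [hyx i hi]) (hsign i hi)
    have hWx := h.eval_root_neg hx hA hB
    obtain ⟨M, hMlt, hM⟩ := exists_lt_eval_sign (p := W (k + 2)) (by omega)
      (by rw [hlead]; positivity) (if k = 0 then x else y (k - 1))
    rw [hdeg] at hM
    -- The k + 2 nodes x > y_0 > ... > y_{k-1} > M, with alternating signs, bound k + 1 gaps that
    -- each contain a zero.
    obtain ⟨t, ht0, hty, htM⟩ : ∃ t : ℕ → ℝ, t 0 = x ∧ (∀ i < k, t (i + 1) = y i) ∧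
        t (k + 1) = M :=
      ⟨fun i => if i = 0 then x else if i ≤ k then y (i - 1) else M, by simp,
        fun i hi => by simp [Nat.succ_le_of_lt hi], by simp⟩
    have htlt : ∀ i < k + 1, t (i + 1) < t i := by
      intro i hi
      rcases Nat.lt_succ_iff_lt_or_eq.1 hi with hik | rfl
      · rw [hty i hik]
        cases i with
        | zero => rw [ht0]; exact hyx 0 hik
        | succ i => rw [hty i (by omega)]; exact hanti _ _ (Nat.lt_succ_self i) hik
      · rw [htM]
        cases i with
        | zero => simpa [ht0] using hMlt
        | succ i => rw [hty i (by omega)]; simpa using hMlt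
    have htneg : ∀ i < k + 1, (-1) ^ i * (W (k + 2)).eval (t i) < 0 := by
      intro i hi
      cases i with
      | zero => simpa [ht0] using hWx (k + 1)
      | succ i =>
        rw [hty i (by omega), pow_succ]
        linarith [hW2y i (by omega)]
    have htpos : ∀ i < k + 1, 0 < (-1) ^ i * (W (k + 2)).eval (t (i + 1)) := by
      intro i hi
      rcases Nat.lt_succ_iff_lt_or_eq.1 hi with hik | rfl
      · have := htneg (i + 1) (by omega)
        rw [pow_succ] at this
        linarith
      · rw [htM]
        rw [pow_succ, pow_succ] at hM
        linarith
    have hex : ∀ i, ∃ r, i < k + 1 → t (i + 1) < r ∧ r < t i ∧ (W (k + 2)).eval r = 0 := by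
      intro i
      by_cases hi : i < k + 1
      · obtain ⟨r, hr⟩ := exists_root_Ioo_of_sign (htlt i hi) (pow_ne_zero i (by norm_num))
          (htpos i hi) (htneg i hi)
        exact ⟨r, fun _ => hr⟩
      · exact ⟨0, fun h => absurd h hi⟩
    choose r hr using hex
    obtain ⟨ξ, hξx, -, hξ⟩ := exists_root_Ioo_of_sign (p := W (k + 2)) (s := -1) hx (by norm_num)
      (by linarith [hWx (k + 1)]) (by linarith [(h.eval_zero_nonneg hb hd k).2.2.2])
    have htle : ∀ j i, i ≤ j → j < k + 1 → t j ≤ t i := by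
      intro j i hij
      induction hij with
      | refl => exact fun _ => le_rfl
      | step _ ih => exact fun hj => (htlt _ (by omega)).le.trans (ih (by omega))
    have hrx : ∀ i < k + 1, r i < x := fun i hi =>
      (hr i hi).2.1.trans_le (ht0 ▸ htle i 0 (Nat.zero_le _) hi)
    have hranti : ∀ i j, i < j → j < k + 1 → r j < r i := fun i j hij hj =>
      ((hr j hj).2.1.trans_le (htle j (i + 1) hij hj)).trans (hr i (by omega)).1
    refine ⟨ξ, r, hξx, hranti, hrx, ?_, ?_⟩
    · intro i hi
      have hs : 0 < (-1) ^ i * ∏ j ∈ Finset.range k, (r i - y j) := by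
        refine prod_range_sub_sign (by omega) (fun j hj => ?_) (fun j hij hj => ?_)
        · rw [← hty j (by omega)]
          exact (hr i hi).2.1.trans_le (htle i (j + 1) hj hi)
        · rw [← hty j hj]
          exact (htle (j + 1) (i + 1) (by omega) (by omega)).trans_lt (hr i hi).1
      rw [hfac, eval_mul, eval_mul, eval_prod]
      simp only [eval_C, eval_sub, eval_X]
      have h1 : 0 < a ^ k := by positivity
      have h2 : r i - ζ < 0 := by linarith [hrx i hi]
      have h3 := mul_neg_of_pos_of_neg h1 (mul_neg_of_neg_of_pos h2 hs)
      calc _ = a ^ k * ((r i - ζ) * ((-1) ^ i * ∏ j ∈ Finset.range k, (r i - y j))) := by ring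
        _ < 0 := h3
    · have := eq_C_mul_prod_of_roots hdeg hξ (fun i hi => (hr i hi).2.2)
        (fun i hi => (hrx i hi).trans hξx) hranti
      rwa [hlead] at this

theorem pow_mul_abs_im_pow_le (h : IsLinRec a b c d W) (ha : 0 < a) (hb : 0 < b) (hc : 0 < c)
    (hd : 0 < d) (hlt : a * d < b * c) (k : ℕ) (z : ℂ) :
    a ^ k * |z.im| ^ (k + 1) ≤ ‖aeval z (W (k + 1))‖ := by
  have hx : -(d / c) < 0 := by simp only [neg_lt_zero]; positivity
  have hA : 0 < a * -(d / c) + b := by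
    have : a * -(d / c) + b = (b * c - a * d) / c := by field_simp; ring
    rw [this]; exact div_pos (by linarith) hc
  have hB : c * -(d / c) + d = 0 := by field_simp; ring
  obtain ⟨ζ, y, -, -, -, -, hfac⟩ := h.exists_factorization ha hb hc hd hx hA hB k
  have him : ∀ r : ℝ, |z.im| ≤ ‖z - (r : ℂ)‖ := fun r => by
    simpa using Complex.abs_im_le_norm (z - (r : ℂ))
  have he : aeval z (W (k + 1)) = (a : ℂ) ^ k * ((z - ζ) * ∏ i ∈ Finset.range k, (z - (y i : ℂ))) := by
    rw [hfac]; simp [map_prod]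
  rw [he, norm_mul, norm_mul, norm_prod, norm_pow, Complex.norm_real, Real.norm_of_nonneg ha.le,
    pow_succ']
  gcongr
  · exact him ζ
  · calc |z.im| ^ k = ∏ _i ∈ Finset.range k, |z.im| := by simp
      _ ≤ _ := Finset.prod_le_prod (fun _ _ => abs_nonneg _) fun i _ => him (y i)

end IsLinRec

/-! ### Passage to the limit in d -/

/-- The polynomials determined by the recurrence with coefficients `a, b, c, d`. -/
noncomputable def linRecPoly (a b c d : ℝ) : ℕ → ℝ[X]
  | 0 => 1
  | 1 => X
  | n + 2 => (C a * X + C b) * linRecPoly a b c d (n + 1) + (C c * X + C d) * linRecPoly a b c d n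

theorem isLinRec_linRecPoly (a b c d : ℝ) : IsLinRec a b c d (linRecPoly a b c d) :=
  ⟨by simp [linRecPoly], by simp [linRecPoly], fun n => by rw [linRecPoly]⟩

theorem continuous_aeval_linRecPoly (a b c : ℝ) (z : ℂ) (n : ℕ) :
    Continuous (fun d => aeval z (linRecPoly a b c d n)) ∧
      Continuous (fun d => aeval z (linRecPoly a b c d (n + 1))) := by
  induction n with
  | zero => simp [linRecPoly, continuous_const]
  | succ n ih =>
    refine ⟨ih.2, ?_⟩
    simp only [(isLinRec_linRecPoly a b c _).aeval_step, Complex.coe_algebraMap]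
    have h1 := ih.1
    have h2 := ih.2
    fun_prop

namespace IsLinRec

variable {a b c d : ℝ} {W : ℕ → ℝ[X]}

theorem eq_linRecPoly (h : IsLinRec a b c d W) (n : ℕ) : W n = linRecPoly a b c d n := by
  induction n using Nat.twoStepInduction with
  | zero => rw [h.zero, linRecPoly]
  | one => rw [h.one, linRecPoly]
  | more n h1 h2 => rw [h.step, h1, h2, linRecPoly]

theorem isRealRooted (h : IsLinRec a b c d W) (ha : 0 < a) (hb : 0 < b) (hc : 0 < c)
    (hd : 0 < d) (hle : a * d ≤ b * c) (n : ℕ) : IsRealRooted (W n) := by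
  intro z hz
  cases n with
  | zero => simp [h.zero] at hz
  | succ k =>
    have hbound : a ^ k * |z.im| ^ (k + 1) ≤ ‖aeval z (linRecPoly a b c d (k + 1))‖ := by
      have hc' := (continuous_aeval_linRecPoly a b c z k).2.norm.tendsto d
      -- Every e in (0, d) satisfies the strict inequality ae < bc.
      refine ge_of_tendsto (hc'.mono_left (nhdsWithin_le_nhds (s := Set.Iio d))) ?_
      filter_upwards [Ioo_mem_nhdsLT hd] with e he
      exact (isLinRec_linRecPoly a b c e).pow_mul_abs_im_pow_le ha hb hc he.1
        ((mul_lt_mul_of_pos_left he.2 ha).trans_le hle) k z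
    rw [← h.eq_linRecPoly, hz, norm_zero] at hbound
    by_contra hne
    have : 0 < a ^ k * |z.im| ^ (k + 1) := by positivity
    linarith

end IsLinRec

/-! ### Necessity: growth at m ± t against growth at m + it -/

/-- Each real zero r contributes |(m-r)² - t²| ≤ (m-r)² + t²; multiply over the zeros. -/
theorem IsRealRooted.norm_aeval_mul_le {p : ℝ[X]} (hp : IsRealRooted p) (m t : ℝ) :
    ‖aeval ((m - t : ℝ) : ℂ) p‖ * ‖aeval ((m + t : ℝ) : ℂ) p‖ ≤
      ‖aeval ((m : ℂ) + t * Complex.I) p‖ ^ 2 := by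
  rcases eq_or_ne p 0 with rfl | hp0
  · simp
  have hfac := fun x : ℂ => (IsAlgClosed.splits (p.map (algebraMap ℝ ℂ))).eval_eq_prod_roots x
  simp only [eval_map_algebraMap] at hfac
  have hreal : ∀ z ∈ (p.map (algebraMap ℝ ℂ)).roots, z.im = 0 := by
    intro z hz
    have := (mem_roots'.1 hz).2
    rw [IsRoot, eval_map_algebraMap] at this
    exact hp z this
  rw [hfac, hfac, hfac]
  generalize (p.map (algebraMap ℝ ℂ)).roots = s at hreal
  simp only [norm_mul, mul_pow]
  rw [mul_mul_mul_comm, ← pow_two]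
  refine mul_le_mul_of_nonneg_left ?_ (by positivity)
  induction s using Multiset.induction with
  | empty => simp
  | cons z s ih =>
    have ih := ih fun w hw => hreal w (Multiset.mem_cons_of_mem hw)
    have hz := hreal z (Multiset.mem_cons_self z s)
    obtain ⟨r, rfl⟩ : ∃ r : ℝ, (r : ℂ) = z := ⟨z.re, Complex.ext (by simp) (by simp [hz])⟩
    simp only [Multiset.map_cons, Multiset.prod_cons, norm_mul, mul_pow]
    rw [mul_mul_mul_comm]
    refine mul_le_mul ?_ ih (by positivity) (by positivity)
    have e : (m : ℂ) + t * Complex.I - r = ((m - r : ℝ) : ℂ) + (t : ℝ) * Complex.I := by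
      push_cast; ring
    rw [← Complex.ofReal_sub, ← Complex.ofReal_sub, Complex.norm_real, Complex.norm_real, e,
      Complex.sq_norm, Complex.normSq_add_mul_I, ← norm_mul, Real.norm_eq_abs, abs_le]
    constructor <;> nlinarith [sq_nonneg (m - r), sq_nonneg t]

namespace IsLinRec

variable {a b c d : ℝ} {W : ℕ → ℝ[X]}

theorem aeval_mul_sub_eq (h : IsLinRec a b c d W) {z l m : ℂ} (hs : l + m = a * z + b)
    (hm : l * m = -(c * z + d)) (n : ℕ) :
    aeval z (W n) * (l - m) = (z - m) * l ^ n + (l - z) * m ^ n := by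
  induction n using Nat.twoStepInduction with
  | zero => simp [h.zero]
  | one => simp [h.one]; ring
  | more n h1 h2 =>
    have e : (c * z + d : ℂ) = -(l * m) := by rw [hm, neg_neg]
    rw [h.aeval_step]
    simp only [Complex.coe_algebraMap]
    rw [← hs, e, add_mul, mul_assoc, h2, mul_assoc, h1]
    ring

open Filter Topology in
theorem tendsto_norm_aeval_div (h : IsLinRec a b c d W) {z l m : ℂ} (hs : l + m = a * z + b)
    (hm : l * m = -(c * z + d)) (hlt : ‖m‖ < ‖l‖) :
    Tendsto (fun n => ‖aeval z (W n)‖ / ‖l‖ ^ n) atTop (𝓝 ‖(z - m) / (l - m)‖) := by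
  have hl : l ≠ 0 := norm_pos_iff.1 ((norm_nonneg m).trans_lt hlt)
  have hlm : l - m ≠ 0 := sub_ne_zero.2 fun e => by simp [e] at hlt
  have hq : Tendsto (fun n => (m / l) ^ n) atTop (𝓝 0) := by
    refine tendsto_pow_atTop_nhds_zero_of_norm_lt_one ?_
    rw [norm_div]
    exact (div_lt_one ((norm_nonneg m).trans_lt hlt)).2 hlt
  have hlim := (((hq.const_mul (l - z)).const_add (z - m)).div_const (l - m)).norm
  rw [mul_zero, add_zero] at hlim
  refine hlim.congr fun n => ?_
  rw [← norm_pow, ← norm_div]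
  congr 1
  rw [div_pow, eq_div_iff (pow_ne_zero n hl), div_mul_eq_mul_div, div_eq_iff hlm,
    h.aeval_mul_sub_eq hs hm]
  field_simp

theorem exists_norm_aeval_le (h : IsLinRec a b c d W) {z l m : ℂ} (hs : l + m = a * z + b)
    (hm : l * m = -(c * z + d)) (hlm : l ≠ m) {R : ℝ} (hlR : ‖l‖ ^ 2 ≤ R) (hmR : ‖m‖ ^ 2 ≤ R) :
    ∃ K : ℝ, ∀ n, ‖aeval z (W n)‖ ^ 2 ≤ K * R ^ n := by
  have hpos : 0 < ‖l - m‖ := norm_pos_iff.2 (sub_ne_zero.2 hlm)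
  refine ⟨2 * (‖z - m‖ ^ 2 + ‖l - z‖ ^ 2) / ‖l - m‖ ^ 2, fun n => ?_⟩
  rw [div_mul_eq_mul_div, le_div_iff₀ (by positivity), ← mul_pow, ← norm_mul,
    h.aeval_mul_sub_eq hs hm]
  have h1 : ‖l ^ n‖ ^ 2 ≤ R ^ n := by
    rw [norm_pow, ← pow_mul, mul_comm, pow_mul]; gcongr
  have h2 : ‖m ^ n‖ ^ 2 ≤ R ^ n := by
    rw [norm_pow, ← pow_mul, mul_comm, pow_mul]; gcongr
  calc ‖(z - m) * l ^ n + (l - z) * m ^ n‖ ^ 2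
      ≤ (‖z - m‖ * ‖l ^ n‖ + ‖l - z‖ * ‖m ^ n‖) ^ 2 := by
        gcongr; exact (norm_add_le _ _).trans (by rw [norm_mul, norm_mul])
    _ ≤ 2 * (‖z - m‖ ^ 2 * ‖l ^ n‖ ^ 2 + ‖l - z‖ ^ 2 * ‖m ^ n‖ ^ 2) := by
        nlinarith [sq_nonneg (‖z - m‖ * ‖l ^ n‖ - ‖l - z‖ * ‖m ^ n‖)]
    _ ≤ 2 * (‖z - m‖ ^ 2 * R ^ n + ‖l - z‖ ^ 2 * R ^ n) := by gcongr
    _ = _ := by ring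

end IsLinRec

open Filter Topology in
theorem not_forall_mul_le_of_growth {f g k : ℕ → ℝ} {α γ R A B K : ℝ} (hα : 0 < α) (hγ : 0 < γ)
    (hR : 0 ≤ R) (hRlt : R < α * γ) (hA : 0 < A) (hB : 0 < B)
    (hf : Tendsto (fun n => f n / α ^ n) atTop (𝓝 A))
    (hg : Tendsto (fun n => g n / γ ^ n) atTop (𝓝 B)) (hk : ∀ n, k n ≤ K * R ^ n) :
    ¬ ∀ n, f n * g n ≤ k n := by
  intro hle
  have hq : Tendsto (fun n => K * (R / (α * γ)) ^ n) atTop (𝓝 (K * 0)) :=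
    (tendsto_pow_atTop_nhds_zero_of_lt_one (by positivity)
      ((div_lt_one (by positivity)).2 hRlt)).const_mul K
  refine (mul_pos hA hB).not_ge ?_
  rw [← mul_zero K]
  refine le_of_tendsto_of_tendsto' (hf.mul hg) hq fun n => ?_
  rw [div_mul_div_comm, ← mul_pow, div_pow, mul_div_assoc']
  exact div_le_div_of_nonneg_right ((hle n).trans (hk n)) (by positivity)

/-- The square of the modulus of the characteristic roots at the point `-b/a + t I`. -/
theorem normSq_le_of_sq_eq {a c β t : ℝ} (hβ : 0 < β) (ht : a ^ 2 * t ^ 2 ≤ 2 * β) {w : ℂ}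
    (hw : w ^ 2 = ((β - a ^ 2 * t ^ 2 / 4 : ℝ) : ℂ) + (c * t : ℝ) * Complex.I) {s : ℝ}
    (hs : s ^ 2 = a ^ 2 * t ^ 2 / 4) :
    ‖w + s * Complex.I‖ ^ 2 ≤ β + (a ^ 2 / 4 + 3 * c ^ 2 / (2 * β)) * t ^ 2 := by
  have hre := congrArg Complex.re hw
  have him := congrArg Complex.im hw
  simp only [pow_two w, Complex.mul_re, Complex.mul_im, Complex.add_re, Complex.add_im,
    Complex.ofReal_re, Complex.ofReal_im, Complex.I_re, Complex.I_im] at hre him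
  have hp : β / 2 ≤ w.re ^ 2 := by nlinarith [sq_nonneg w.im]
  have hpq : 4 * w.re ^ 2 * w.im ^ 2 = c ^ 2 * t ^ 2 := by
    have : 2 * w.re * w.im = c * t := by linarith
    rw [← mul_pow, ← this]; ring
  have hq : w.im ^ 2 ≤ c ^ 2 * t ^ 2 / (2 * β) := by
    rw [le_div_iff₀ (by positivity)]
    nlinarith [sq_nonneg w.im]
  rw [Complex.sq_norm, Complex.normSq_apply]
  simp only [Complex.add_re, Complex.add_im, Complex.mul_re, Complex.mul_im,
    Complex.ofReal_re, Complex.ofReal_im, Complex.I_re, Complex.I_im]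
  have e : (a ^ 2 / 4 + 3 * c ^ 2 / (2 * β)) * t ^ 2 =
      a ^ 2 * t ^ 2 / 4 + 3 * (c ^ 2 * t ^ 2 / (2 * β)) := by ring
  rw [e]
  -- Uses (Im w + s)² ≤ 2 (Im w)² + 2s².
  nlinarith [sq_nonneg (w.im - s)]

/-- Lower bound for the product of the dominant characteristic roots at `-b/a ± t`. -/
theorem lt_mul_of_small {a c β t : ℝ} (ha : 0 < a) (hc : 0 < c) (hβ : 0 < β) (ht : 0 < t)
    (hct : c * t < β)
    (hsmall : (a ^ 2 / 4 + 5 * c ^ 2 / (2 * β)) * t < a * √β / 2) :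
    β + (a ^ 2 / 4 + 3 * c ^ 2 / (2 * β)) * t ^ 2 <
      (a * t / 2 + √(a ^ 2 * t ^ 2 / 4 + (β + c * t))) *
        (a * t / 2 + √(a ^ 2 * t ^ 2 / 4 + (β - c * t))) := by
  have hS : √(β + c * t) ≤ √(a ^ 2 * t ^ 2 / 4 + (β + c * t)) :=
    Real.sqrt_le_sqrt (by nlinarith [sq_nonneg (a * t)])
  have hT : √(β - c * t) ≤ √(a ^ 2 * t ^ 2 / 4 + (β - c * t)) :=
    Real.sqrt_le_sqrt (by nlinarith [sq_nonneg (a * t)])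
  have hST : β - c ^ 2 * t ^ 2 / β ≤ √(β + c * t) * √(β - c * t) := by
    rw [← Real.sqrt_mul (by positivity)]
    refine Real.le_sqrt_of_sq_le ?_
    have h1 : c ^ 2 * t ^ 2 / β * β = c ^ 2 * t ^ 2 := by field_simp
    have h2 : c ^ 2 * t ^ 2 / β ≤ β := by
      rw [div_le_iff₀ hβ]; nlinarith [mul_pos hc ht]
    have h3 : 0 ≤ c ^ 2 * t ^ 2 / β := by positivity
    nlinarith
  have hSβ : √β ≤ √(β + c * t) := Real.sqrt_le_sqrt (by nlinarith [mul_pos hc ht])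
  have hT0 := Real.sqrt_nonneg (β - c * t)
  have hS0 := Real.sqrt_nonneg (β + c * t)
  have hat : 0 < a * t / 2 := by positivity
  have h4 : a * t / 2 * √β ≤ a * t / 2 * √(β + c * t) := by gcongr
  have h5 := mul_lt_mul_of_pos_right hsmall ht
  have e5 : (a ^ 2 / 4 + 5 * c ^ 2 / (2 * β)) * t * t =
    (a ^ 2 / 4 + 3 * c ^ 2 / (2 * β)) * t ^ 2 + c ^ 2 * t ^ 2 / β := by field_simp; ring
  calc β + (a ^ 2 / 4 + 3 * c ^ 2 / (2 * β)) * t ^ 2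
      < (a * t / 2 + √(β + c * t)) * (a * t / 2 + √(β - c * t)) := by
        nlinarith [mul_nonneg hat.le hT0, mul_pos hat hat]
    _ ≤ _ := by gcongr

theorem finite_setOf_quadratic_eq_zero {p q r : ℝ} (hr : r ≠ 0) :
    {x : ℝ | p * x ^ 2 + q * x + r = 0}.Finite := by
  have hne : (C p * X ^ 2 + C q * X + C r : ℝ[X]) ≠ 0 := by
    intro h
    have := congrArg (eval 0) h
    simp at this
    exact hr this
  refine (finite_setOfPred_isRoot hne).subset fun x hx => ?_
  simpa using hx

open Filter Topology in
theorem exists_small_of_finite {a c β m K s : ℝ} (hβ : 0 < β) (hs : 0 < s) {F : Set ℝ}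
    (hF : F.Finite) :
    ∃ t > 0, c * t < β ∧ a ^ 2 * t ^ 2 ≤ 2 * β ∧ K * t < s ∧ m + t ∉ F := by
  have h1 : ∀ᶠ t in 𝓝[>] (0 : ℝ), c * t < β :=
    (tendsto_nhdsWithin_of_tendsto_nhds (by
      simpa using (continuous_const_mul c).tendsto 0)).eventually_lt_const hβ
  have h2 : ∀ᶠ t in 𝓝[>] (0 : ℝ), a ^ 2 * t ^ 2 < 2 * β := by
    have : Continuous fun t : ℝ => a ^ 2 * t ^ 2 := by fun_prop
    exact (tendsto_nhdsWithin_of_tendsto_nhds (by simpa using this.tendsto 0)).eventually_lt_const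
      (by positivity)
  have h3 : ∀ᶠ t in 𝓝[>] (0 : ℝ), K * t < s :=
    (tendsto_nhdsWithin_of_tendsto_nhds (by
      simpa using (continuous_const_mul K).tendsto 0)).eventually_lt_const hs
  have hF' : ((m + ·) ⁻¹' F).Finite := hF.preimage (add_right_injective m).injOn
  have h4 : ∀ᶠ t in 𝓝[>] (0 : ℝ), m + t ∉ F := by
    have : ((m + ·) ⁻¹' F)ᶜ ∈ 𝓝[≠] (0 : ℝ) := by
      have := (hF'.subset (Set.sdiff_subset (t := {0}))).isClosed.isOpen_compl.mem_nhds
        (x := (0 : ℝ)) (by simp)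
      filter_upwards [nhdsWithin_le_nhds this, self_mem_nhdsWithin] with x hx hx0 hxF
      exact hx ⟨hxF, hx0⟩
    exact nhdsWithin_mono 0 (fun x hx => ne_of_gt hx) this
  obtain ⟨t, ⟨⟨⟨⟨p1, p2⟩, p3⟩, p4⟩, p5⟩⟩ :=
    ((((h1.and h2).and h3).and h4).and self_mem_nhdsWithin).exists
  exact ⟨t, p5, p1, p2.le, p3, p4⟩

theorem IsLinRec.mul_le_mul_of_isRealRooted {a b c d : ℝ} {W : ℕ → ℝ[X]}
    (h : IsLinRec a b c d W) (ha : 0 < a) (hb : 0 < b) (hc : 0 < c) (hd : 0 < d)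
    (hreal : ∀ n, IsRealRooted (W n)) : a * d ≤ b * c := by
  by_contra! hlt
  obtain ⟨m, hm⟩ : ∃ m, a * m + b = 0 := ⟨-(b / a), by field_simp; ring⟩
  obtain ⟨β, hβm⟩ : ∃ β, c * m + d = β := ⟨_, rfl⟩
  have hβ : 0 < β := by
    have : a * β = a * d - b * c := by rw [← hβm]; linear_combination c * hm
    exact pos_of_mul_pos_right (a := a) (by linarith) ha.le
  have hm0 : m < 0 := by nlinarith
  obtain ⟨t, ht, hct, hat, hsmall, hF⟩ := exists_small_of_finite (a := a) (c := c) (m := m)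
    (K := a ^ 2 / 4 + 5 * c ^ 2 / (2 * β)) (s := a * √β / 2) hβ (by positivity)
    -- The quadratic is x² - (ax + b)x - (cx + d): its zeros are the points that are their own
    -- characteristic root, where the dominant Binet coefficient could vanish.
    (finite_setOf_quadratic_eq_zero (p := 1 - a) (q := -(b + c)) (neg_ne_zero.2 hd.ne'))
  have hRlt := lt_mul_of_small ha hc hβ ht hct hsmall
  obtain ⟨S, hS⟩ : ∃ S, √(a ^ 2 * t ^ 2 / 4 + (β + c * t)) = S := ⟨_, rfl⟩
  obtain ⟨T, hT⟩ : ∃ T, √(a ^ 2 * t ^ 2 / 4 + (β - c * t)) = T := ⟨_, rfl⟩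
  have hS2 : S ^ 2 = a ^ 2 * t ^ 2 / 4 + (β + c * t) := by
    rw [← hS, Real.sq_sqrt (by positivity)]
  have hT2 : T ^ 2 = a ^ 2 * t ^ 2 / 4 + (β - c * t) := by
    rw [← hT, Real.sq_sqrt (by have := sub_pos.2 hct; positivity)]
  have hS0 : 0 < S := by rw [← hS]; positivity
  have hT0 : 0 < T := by rw [← hT]; have := sub_pos.2 hct; positivity
  rw [hS, hT] at hRlt
  have hat0 : 0 < a * t / 2 := by positivity
  -- the three points `m + t`, `m - t`, `m + t I`
  have hmC : (a : ℂ) * m + b = 0 := by exact_mod_cast hm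
  have hβC : (c : ℂ) * m + d = β := by exact_mod_cast hβm
  have hv := h.tendsto_norm_aeval_div (z := ((m + t : ℝ) : ℂ)) (l := ((a * t / 2 + S : ℝ) : ℂ))
    (m := ((a * t / 2 - S : ℝ) : ℂ)) (by push_cast; linear_combination -hmC)
    (by norm_cast; linear_combination -hS2 + hβm) (by
      rw [Complex.norm_real, Complex.norm_real, Real.norm_eq_abs, Real.norm_of_nonneg (by linarith),
        abs_lt]
      constructor <;> linarith)
  have hu := h.tendsto_norm_aeval_div (z := ((m - t : ℝ) : ℂ)) (l := ((-(a * t / 2) - T : ℝ) : ℂ))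
    (m := ((-(a * t / 2) + T : ℝ) : ℂ)) (by push_cast; linear_combination -hmC)
    (by norm_cast; linear_combination -hT2 + hβm) (by
      rw [Complex.norm_real, Complex.norm_real, Real.norm_eq_abs,
        Real.norm_of_nonpos (by linarith), abs_lt]
      constructor <;> linarith)
  rw [← Complex.ofReal_sub, ← Complex.ofReal_sub, ← Complex.ofReal_div] at hu hv
  simp only [Complex.norm_real] at hu hv
  rw [Real.norm_of_nonneg (by linarith : 0 ≤ a * t / 2 + S)] at hv
  rw [Real.norm_of_nonpos (by linarith : -(a * t / 2) - T ≤ 0)] at hu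
  -- w² is a quarter of the characteristic discriminant at m + it.
  obtain ⟨w, hw⟩ := IsAlgClosed.exists_pow_nat_eq
    (((β - a ^ 2 * t ^ 2 / 4 : ℝ) : ℂ) + (c * t : ℝ) * Complex.I) two_pos
  have hw0 : w ≠ 0 := by
    rintro rfl
    have := congrArg Complex.im hw
    rw [Complex.add_im, Complex.ofReal_im, Complex.im_ofReal_mul] at this
    simp at this
    rcases this with e | e
    · exact hc.ne' e
    · exact ht.ne' e
  obtain ⟨K, hK⟩ := h.exists_norm_aeval_le (z := (m : ℂ) + t * Complex.I)
    (l := w + (a * t / 2 : ℝ) * Complex.I) (m := -(w + (-(a * t / 2) : ℝ) * Complex.I))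
    (R := β + (a ^ 2 / 4 + 3 * c ^ 2 / (2 * β)) * t ^ 2)
    (by push_cast; linear_combination -hmC)
    (by
      push_cast at hw ⊢
      linear_combination -hw + hβC - (a * t / 2 : ℂ) ^ 2 * -Complex.I_sq)
    (by
      intro e
      have : 2 * w = 0 := by push_cast at e; linear_combination e
      simp [hw0] at this)
    (normSq_le_of_sq_eq hβ hat hw (by ring))
    (by rw [norm_neg]; exact normSq_le_of_sq_eq hβ hat hw (by ring))
  refine not_forall_mul_le_of_growth (γ := a * t / 2 + S) (α := -(-(a * t / 2) - T))
    (by linarith) (by linarith) (by positivity) (by linarith) ?_ ?_ hu hv hK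
    fun n => (hreal n).norm_aeval_mul_le m t
  · rw [norm_pos_iff]
    -- The subdominant root at m - t is thus positive, whereas m - t < 0.
    have : a * t / 2 < T := lt_of_pow_lt_pow_left₀ 2 hT0.le (by nlinarith)
    exact div_ne_zero (by linarith) (by linarith)
  · rw [norm_pos_iff]
    refine div_ne_zero (fun e => hF ?_) (by linarith)
    have e2 : m + t = a * t / 2 - S := by linarith
    change (1 - a) * (m + t) ^ 2 + -(b + c) * (m + t) + -d = 0
    linear_combination (m + t - a * t / 2 - S) * e2 + hS2 - (m + t) * hm - hβm

theorem theorem2p1 (a b c d : ℝ) (ha : 0 < a) (hb : 0 < b) (hc : 0 < c) (hd : 0 < d)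
    (W : ℕ → ℝ[X]) (hW0 : W 0 = 1) (hW1 : W 1 = X)
    (hW : ∀ n : ℕ, W (n + 2) = (C a * X + C b) * W (n + 1) + (C c * X + C d) * W n) :
    (∀ n : ℕ, IsRealRooted (W n)) ↔ a * d ≤ b * c :=
  have h : IsLinRec a b c d W := ⟨hW0, hW1, hW⟩
  ⟨h.mul_le_mul_of_isRealRooted ha hb hc hd, fun hle n => h.isRealRooted ha hb hc hd hle n⟩
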